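/- Let $n>m>0$ be coprime integers. Let $\Omega_n\subset\mathbb{P}^2_{\mathbb{C}}$ be the set of points $[1:b:c]$, $b,c\in\mathbb{C}$ (zero allowed), such that all complex roots of $\zeta^n+b\zeta^m+c$ lie in the open unit disc, and let $\Pi_n:\Omega_n\to\mathbb{P}^2_{\mathbb{R}}$ be defined by \[ \Pi_n([1:b:c])=[1:|b|:(-1)^n|c|]. \] For real $x,y$ with $x>0$ and $y\neq 0$ put \[ \omega(x,y)=\frac{n\arccos\left(\frac{x^2+y^2-1}{2x|y|}\right)+m\arccos\left(\frac{1-x^2+y^2}{2|y|}\right)}{2\pi} \] whenever both arguments of $\arccos$ lie in $[-1,1]$, and let \begin{align*} \Gamma_0&=\{[1:x:y]\in\mathbb{P}^2_{\mathbb{R}} : 0\le x,\ 0\le y,\ x+y<1\},\\ \Delta_0&=\{[1:x:y]\in\mathbb{P}^2_{\mathbb{R}} : 0<x,\ 0<y,\ 1\le x+y,\ n-1<2\omega(x,y)\le n\},\\ \Gamma_1&=\{[1:x:y]\in\mathbb{P}^2_{\mathbb{R}} : 0\le x,\ y\le 0,\ x-y<1\},\\ \Delta_1&=\{[1:x:y]\in\mathbb{P}^2_{\mathbb{R}}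 : 0<x,\ y<0,\ 1\le x-y,\ n-1<2\omega(x,y)\le n\}, \end{align*} where membership in $\Delta_0$ or $\Delta_1$ includes that $\omega(x,y)$ is defined. (The sets are the same if $\arccos$ is extended to $\mathbb{R}$ by $\arccos s=0$ for $s>1$ and $\arccos s=\pi$ for $s<-1$.) Then \[ \Pi_n(\Omega_n)=\begin{cases}\Delta_0\cup\Gamma_0 & \text{if } n \text{ is even},\\ \Delta_1\cup\Gamma_1 & \text{if } n \text{ is odd}.\end{cases} \] -/

import Mathlib

open scoped LinearAlgebra.Projectivization

namespace SchurTrinomial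

/-- The projective plane `ℙ²` over a field `K`: lines through the origin of `K³`. -/
abbrev Plane (K : Type) [Field K] : Type := ℙ K (Fin 3 → K)

/-- The point `[1 : x : y]` of the projective plane over `K`. -/
def point {K : Type} [Field K] (x y : K) : Plane K :=
  Projectivization.mk K ![1, x, y] (fun h => one_ne_zero (congrFun h 0))

/-- The trinomial `a ζ ^ n + b ζ ^ m + c` is Schur stable: all its complex roots lie in the open
unit disc. -/
def SchurStable (n m : ℕ) (a b c : ℂ) : Prop :=
  ∀ ζ : ℂ, a * ζ ^ n + b * ζ ^ m + c = 0 → ‖ζ‖ < 1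

/-- The stability region `Ω_n`: the points `[1 : b : c]` of the complex projective plane for which
`ζ ^ n + b ζ ^ m + c` is Schur stable. -/
def stabilityRegion (n m : ℕ) : Set (Plane ℂ) :=
  {p | ∃ b c : ℂ, p = point b c ∧ SchurStable n m 1 b c}

/-- The projection `Π_n : Ω_n → ℙ²(ℝ)`. If `(a, b, c)` is any representative of a point of `Ω_n`
then `a ≠ 0` and the point is `[1 : b / a : c / a]`; it is sent to
`[1 : |b / a| : (-1) ^ n |c / a|]`. See `projection_point` for the value at `[1 : b : c]`. -/
noncomputable def projection (n m : ℕ) (p : stabilityRegion n m) : Plane ℝ :=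
  point ‖p.1.rep 1 / p.1.rep 0‖ ((-1) ^ n * ‖p.1.rep 2 / p.1.rep 0‖)

/-- `Π_n([1 : b : c]) = [1 : |b| : (-1) ^ n |c|]`. -/
theorem projection_point (n m : ℕ) (b c : ℂ) (h : point b c ∈ stabilityRegion n m) :
    projection n m ⟨point b c, h⟩ = point ‖b‖ ((-1) ^ n * ‖c‖) := by
  obtain ⟨u, hu⟩ := Projectivization.exists_smul_eq_mk_rep ℂ ![1, b, c]
    (fun h => one_ne_zero (congrFun h 0))
  have hr : (point b c).rep = u • ![1, b, c] := hu.symm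
  have hu0 : (u : ℂ) ≠ 0 := u.ne_zero
  simp [projection, hr, Units.smul_def, hu0]

/-- The quantity `ω(x, y)`. For `x, |y| > 0` the two arccosines are the angles opposite to the
sides of lengths `1` and `x` in a (possibly degenerate) triangle with sides `1`, `x`, `|y|`. -/
noncomputable def omega (n m : ℕ) (x y : ℝ) : ℝ :=
  (n * Real.arccos ((x ^ 2 + y ^ 2 - 1) / (2 * x * |y|)) +
    m * Real.arccos ((1 - x ^ 2 + y ^ 2) / (2 * |y|))) / (2 * Real.pi)

/-- The set `Γ₀`. -/
def Gamma0 : Set (Plane ℝ) :=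
  {p | ∃ x y : ℝ, p = point x y ∧ 0 ≤ x ∧ 0 ≤ y ∧ x + y < 1}

/-- The set `Γ₁`. -/
def Gamma1 : Set (Plane ℝ) :=
  {p | ∃ x y : ℝ, p = point x y ∧ 0 ≤ x ∧ y ≤ 0 ∧ x - y < 1}

/-- The set `Δ₀`. When `1`, `x`, `y` violate the triangle inequality although `1 ≤ x + y`, an
arccosine in `omega` has its argument outside `[-1, 1]`. `Real.arccos` is constant on each side of
`[-1, 1]`, which gives `2 ω = m` (if `x > 1 + y`) or `2 ω = 0` (if `y > 1 + x`); as
`m ≤ n - 1`, such points are not in the set. -/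
def Delta0 (n m : ℕ) : Set (Plane ℝ) :=
  {p | ∃ x y : ℝ, p = point x y ∧ 0 < x ∧ 0 < y ∧ 1 ≤ x + y ∧
    (n : ℝ) - 1 < 2 * omega n m x y ∧ 2 * omega n m x y ≤ n}

/-- The set `Δ₁`; the remark on `Delta0` applies with `|y|` in place of `y`. -/
def Delta1 (n m : ℕ) : Set (Plane ℝ) :=
  {p | ∃ x y : ℝ, p = point x y ∧ 0 < x ∧ y < 0 ∧ 1 ≤ x - y ∧
    (n : ℝ) - 1 < 2 * omega n m x y ∧ 2 * omega n m x y ≤ n}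

end SchurTrinomial

open scoped ComplexConjugate

namespace SchurTrinomial

/-! Let `f = z^n + b z^m + c` have reciprocal `f'`. When `|c| < 1`, Schur–Cohn reduction replaces
`f` by `f - c f'` without changing stability (`schur_step`). For a trinomial this is a power of `z`
times a trinomial of degree `max(m, n - m)` with middle exponent `|n - 2m|`. Since any coefficients
of the reduced trinomial with the right moduli can be lifted, the reduction descends to the moduli
`x = |b|`, `y = |c|` (`attainable_low`, `attainable_high`).

The region reduces in the same way. Let `α, β, γ` be the angles opposite `1, x, y` in a triangle
with these sides. The reduced moduli give a triangle with angles `α - γ, γ, π - α`, and `α + β + γ =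
π` turns `(n - 1)π < nα + mβ` into the corresponding inequality for the reduced exponents
(`inRegion_low`, `inRegion_high`). By coprimality the descent ends at exponents `2, 1`, where for `y
< 1` both conditions say `x < 1 + y`. -/

/-! ### Stable polynomials and their reciprocals -/

theorem norm_mul_norm_inv_conj_sub_le {z r : ℂ} (hz : 1 ≤ ‖z‖) (hr : ‖r‖ ≤ 1) :
    ‖z‖ * ‖(conj z)⁻¹ - r‖ ≤ ‖z - r‖ := by
  have hz0 : conj z ≠ 0 := by
    intro h
    rw [map_eq_zero] at h
    simp [h] at hz
    linarith
  have h1 : ‖z‖ * ‖(conj z)⁻¹ - r‖ = ‖1 - conj z * r‖ := by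
    rw [← Complex.norm_conj z, ← norm_mul, mul_sub, mul_inv_cancel₀ hz0]
  rw [h1]
  refine le_of_sq_le_sq ?_ (norm_nonneg _)
  have hz2 : 1 ≤ z.re * z.re + z.im * z.im := by
    rw [← Complex.normSq_apply, Complex.normSq_eq_norm_sq]
    nlinarith
  have hr2 : r.re * r.re + r.im * r.im ≤ 1 := by
    rw [← Complex.normSq_apply, Complex.normSq_eq_norm_sq]
    nlinarith [norm_nonneg r]
  rw [← Complex.normSq_eq_norm_sq, ← Complex.normSq_eq_norm_sq, Complex.normSq_apply,
    Complex.normSq_apply]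
  simp only [Complex.sub_re, Complex.sub_im, Complex.mul_re, Complex.mul_im, Complex.one_re,
    Complex.one_im, Complex.conj_re, Complex.conj_im]
  -- The squares differ by `(|z|^2 - 1)(1 - |r|^2)`.
  nlinarith [mul_nonneg (sub_nonneg.2 hz2) (sub_nonneg.2 hr2)]

/-- A polynomial with all roots in the closed unit disc dominates its reciprocal polynomial
outside the open unit disc. -/
theorem norm_pow_mul_norm_eval_inv_conj_le {p : Polynomial ℂ} (hp : ∀ r ∈ p.roots, ‖r‖ ≤ 1)
    {z : ℂ} (hz : 1 ≤ ‖z‖) :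
    ‖z‖ ^ p.natDegree * ‖p.eval (conj z)⁻¹‖ ≤ ‖p.eval z‖ := by
  have hs := IsAlgClosed.splits p
  have key : ∀ s : Multiset ℂ, (∀ r ∈ s, ‖r‖ ≤ 1) →
      ‖z‖ ^ s.card * ‖(s.map fun r => (conj z)⁻¹ - r).prod‖ ≤ ‖(s.map fun r => z - r).prod‖ := by
    intro s
    induction s using Multiset.induction_on with
    | empty => simp
    | cons r s ih =>
      intro h
      have h1 := norm_mul_norm_inv_conj_sub_le hz (h r (Multiset.mem_cons_self r s))
      have h2 := ih fun t ht => h t (Multiset.mem_cons_of_mem ht)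
      rw [Multiset.map_cons, Multiset.map_cons, Multiset.prod_cons, Multiset.prod_cons,
        Multiset.card_cons, norm_mul, norm_mul]
      calc _ = (‖z‖ * ‖(conj z)⁻¹ - r‖) *
            (‖z‖ ^ s.card * ‖(s.map fun r => (conj z)⁻¹ - r).prod‖) := by ring
        _ ≤ _ := by gcongr
  rw [hs.eval_eq_prod_roots, hs.eval_eq_prod_roots, hs.natDegree_eq_card_roots, norm_mul, norm_mul,
    mul_left_comm]
  exact mul_le_mul_of_nonneg_left (key _ hp) (norm_nonneg _)

theorem natDegree_trinomial {n m : ℕ} (hmn : m < n) {a : ℂ} (ha : a ≠ 0) (b c : ℂ) :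
    (Polynomial.C a * Polynomial.X ^ n + Polynomial.C b * Polynomial.X ^ m +
      Polynomial.C c).natDegree = n := by
  compute_degree!
  · simp [hmn.ne', (Nat.zero_lt_of_lt hmn).ne', ha]
  all_goals exact hmn.le

theorem norm_reciprocal_le {n m : ℕ} (hmn : m < n) {a b c : ℂ} (ha : a ≠ 0)
    (hs : SchurStable n m a b c) {z : ℂ} (hz : 1 ≤ ‖z‖) :
    ‖conj a + conj b * z ^ (n - m) + conj c * z ^ n‖ ≤ ‖a * z ^ n + b * z ^ m + c‖ := by
  have hz0 : z ≠ 0 := by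
    rintro rfl
    simp at hz
    linarith
  have h := norm_pow_mul_norm_eval_inv_conj_le (p := Polynomial.C a * Polynomial.X ^ n +
    Polynomial.C b * Polynomial.X ^ m + Polynomial.C c) (fun r hr => (hs r (by
      simpa using (Polynomial.isRoot_of_mem_roots hr).eq_zero)).le) hz
  rw [natDegree_trinomial hmn ha] at h
  simp only [Polynomial.eval_add, Polynomial.eval_mul, Polynomial.eval_C, Polynomial.eval_pow,
    Polynomial.eval_X] at h
  refine le_of_eq_of_le ?_ h
  rw [← norm_pow, ← Complex.norm_conj (a * _ + _ + _), ← norm_mul]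
  congr 1
  obtain ⟨k, rfl⟩ := Nat.exists_eq_add_of_lt hmn
  have : m + k + 1 - m = k + 1 := by omega
  rw [this]
  simp only [map_add, map_mul, map_pow, map_inv₀, Complex.conj_conj, inv_pow]
  field_simp
  ring

/-- Up to sign, `c` is the product of the `n > 0` roots. -/
theorem norm_lt_one_of_schurStable {n m : ℕ} (hm : 0 < m) (hmn : m < n) {b c : ℂ}
    (hs : SchurStable n m 1 b c) : ‖c‖ < 1 := by
  set p : Polynomial ℂ := Polynomial.C 1 * Polynomial.X ^ n + Polynomial.C b * Polynomial.X ^ m +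
    Polynomial.C c with hp
  have hd : p.natDegree = n := natDegree_trinomial hmn one_ne_zero b c
  have hroots : ∀ r ∈ p.roots, ‖r‖ < 1 := fun r hr => hs r (by
    simpa [hp] using (Polynomial.isRoot_of_mem_roots hr).eq_zero)
  have hsp := IsAlgClosed.splits p
  have hcard : p.roots.card = n := by rw [← hd, hsp.natDegree_eq_card_roots]
  have hlead : p.leadingCoeff = 1 := by
    rw [Polynomial.leadingCoeff, hd]
    simp [hp, hmn.ne', Polynomial.coeff_X_pow, Polynomial.coeff_C, (hm.trans hmn).ne']
  have h0 : c = (p.roots.map fun r => 0 - r).prod := by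
    have h1 := hsp.eval_eq_prod_roots 0
    rw [hlead, one_mul] at h1
    rw [← h1]
    simp [hp, hm.ne', (hm.trans hmn).ne']
  have key : ∀ s : Multiset ℂ, (∀ r ∈ s, ‖r‖ < 1) →
      ‖(s.map fun r => 0 - r).prod‖ ≤ 1 ∧ (s ≠ 0 → ‖(s.map fun r => 0 - r).prod‖ < 1) := by
    intro s
    induction s using Multiset.induction_on with
    | empty => simp
    | cons r s ih =>
      intro h
      have h1 := h r (Multiset.mem_cons_self r s)
      have h2 := (ih fun t ht => h t (Multiset.mem_cons_of_mem ht)).1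
      have h3 : ‖((r ::ₘ s).map fun r => 0 - r).prod‖ < 1 := by
        rw [Multiset.map_cons, Multiset.prod_cons, norm_mul, zero_sub, norm_neg]
        exact mul_lt_one_of_nonneg_of_lt_one_left (norm_nonneg _) h1 h2
      exact ⟨h3.le, fun _ => h3⟩
  rw [h0]
  refine (key _ hroots).2 ?_
  intro h
  rw [h] at hcard
  simp at hcard
  omega

theorem schurStable_of_norm_add_norm_lt_one {n m : ℕ} (hmn : m < n) {b c : ℂ}
    (h : ‖b‖ + ‖c‖ < 1) : SchurStable n m 1 b c := by
  intro z hz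
  by_contra! h1
  have e : z ^ n = -(b * z ^ m + c) := by linear_combination hz
  have e2 : ‖z‖ ^ n ≤ ‖b‖ * ‖z‖ ^ m + ‖c‖ := by
    rw [← norm_pow, e, norm_neg, ← norm_pow, ← norm_mul]
    exact norm_add_le _ _
  have e3 : ‖z‖ ^ m ≤ ‖z‖ ^ n := pow_le_pow_right₀ h1 hmn.le
  have e4 : 1 ≤ ‖z‖ ^ n := one_le_pow₀ h1
  nlinarith [norm_nonneg b, norm_nonneg c]

/-! ### Schur–Cohn reduction of trinomials -/

theorem schurStable_div {n m : ℕ} {a : ℂ} (ha : a ≠ 0) (b c : ℂ) :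
    SchurStable n m 1 (b / a) (c / a) ↔ SchurStable n m a b c := by
  refine forall_congr' fun z => ?_
  have : a * z ^ n + b * z ^ m + c = a * (1 * z ^ n + b / a * z ^ m + c / a) := by
    field_simp
  rw [this, mul_eq_zero_iff_left ha]

/-- One step of the Schur–Cohn reduction: let `f` be a polynomial with reciprocal `f'` and
`g = z ^ k h` a polynomial with reciprocal `h'` such that `g = f - c f'`. Then stability of `f` and
of `h` are equivalent. -/
theorem schur_step {n m n' m' k : ℕ} {b c a' b' c' : ℂ} (hmn : m < n) (hmn' : m' < n')
    (hc : ‖c‖ < 1) (ha' : a' ≠ 0)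
    (h1 : ∀ z : ℂ, z ^ k * (a' * z ^ n' + b' * z ^ m' + c') = 1 * z ^ n + b * z ^ m + c -
      c * (conj 1 + conj b * z ^ (n - m) + conj c * z ^ n))
    (h2 : ∀ z : ℂ, conj a' + conj b' * z ^ (n' - m') + conj c' * z ^ n' =
      (conj 1 + conj b * z ^ (n - m) + conj c * z ^ n) - conj c * (1 * z ^ n + b * z ^ m + c)) :
    SchurStable n m 1 b c ↔ SchurStable n' m' a' b' c' := by
  -- At a zero of one polynomial outside the open disc, let `u` be the value of the other, stable
  -- one and `t` the modulus of its reciprocal there. The relation between the two gives the first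
  -- bound and stability the second, so `u = 0`, a contradiction.
  have small : ∀ u : ℂ, ∀ t : ℝ, ‖u‖ ≤ ‖c‖ * t → t ≤ ‖u‖ → u = 0 := by
    intro u t h3 h4
    rw [← norm_le_zero_iff]
    nlinarith [norm_nonneg u, norm_nonneg c, mul_le_mul_of_nonneg_left h4 (norm_nonneg c)]
  constructor
  · intro hs z hz
    by_contra! hz1
    have h3 := norm_reciprocal_le hmn one_ne_zero hs hz1
    have h4 := h1 z
    rw [hz, mul_zero] at h4
    refine absurd (hs z (small _ _ ?_ h3)) (not_lt.2 hz1)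
    rw [sub_eq_zero.1 h4.symm, norm_mul]
  · intro hs z hz
    by_contra! hz1
    have h3 := norm_reciprocal_le hmn' ha' hs hz1
    have h4 := h1 z
    have h5 := h2 z
    rw [hz, mul_zero, sub_zero] at h5
    rw [hz, zero_sub, ← h5] at h4
    refine absurd (hs z (small _ _ ?_ h3)) (not_lt.2 hz1)
    have h6 := congrArg norm h4
    rw [norm_mul, norm_neg, norm_mul, norm_pow] at h6
    rw [← h6]
    exact le_mul_of_one_le_left (norm_nonneg _) (one_le_pow₀ hz1)

theorem one_sub_mul_conj_ne_zero {c : ℂ} (hc : ‖c‖ < 1) : 1 - c * conj c ≠ 0 := by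
  rw [Complex.mul_conj, Complex.normSq_eq_norm_sq]
  norm_cast
  nlinarith [norm_nonneg c]

/-- Here `f - c f' = (1 - |c|^2) z^n + b z^m - c b̄ z^(n-m)`, and `z^d` with `d = min(m, n - m)`
factors out. Whether `m` or `n - m` is smaller decides which of `b`, `-c b̄` becomes the constant
term. -/
theorem schur_step_low {d : ℕ} (e : ℕ) (hd : 0 < d) (b : ℂ) {c : ℂ} (hc : ‖c‖ < 1) :
    SchurStable (2 * d + e) d 1 b c ↔
      SchurStable (d + e) e (1 - c * conj c) (-c * conj b) b := by
  refine schur_step (k := d) (by omega) (by omega) hc (one_sub_mul_conj_ne_zero hc) ?_ ?_ <;>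
  · intro z
    have h1 : 2 * d + e - d = d + e := by omega
    have h2 : d + e - e = d := by omega
    simp only [h1, h2, map_sub, map_one, map_mul, map_neg, Complex.conj_conj]
    ring

theorem schur_step_high {d : ℕ} (e : ℕ) (hd : 0 < d) (b : ℂ) {c : ℂ} (hc : ‖c‖ < 1) :
    SchurStable (2 * d + e) (d + e) 1 b c ↔
      SchurStable (d + e) e (1 - c * conj c) b (-c * conj b) := by
  refine schur_step (k := d) (by omega) (by omega) hc (one_sub_mul_conj_ne_zero hc) ?_ ?_ <;>
  · intro z
    have h1 : 2 * d + e - (d + e) = d := by omega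
    have h2 : d + e - e = d := by omega
    simp only [h1, h2, map_sub, map_one, map_mul, map_neg, Complex.conj_conj]
    ring

/-! ### Reduction of the moduli -/

/-- Some trinomial `z ^ n + b z ^ m + c` with `|b| = x`, `|c| = y` is Schur stable. -/
def Attainable (n m : ℕ) (x y : ℝ) : Prop :=
  ∃ b c : ℂ, ‖b‖ = x ∧ ‖c‖ = y ∧ SchurStable n m 1 b c

theorem norm_one_sub_mul_conj {c : ℂ} (hc : ‖c‖ < 1) : ‖1 - c * conj c‖ = 1 - ‖c‖ ^ 2 := by
  rw [Complex.mul_conj, Complex.normSq_eq_norm_sq]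
  norm_cast
  rw [Real.norm_of_nonneg]
  nlinarith [norm_nonneg c]

theorem attainable_low {d : ℕ} (e : ℕ) (hd : 0 < d) {x y : ℝ} (hx : 0 < x) (hy : 0 < y)
    (hy1 : y < 1) : Attainable (2 * d + e) d x y ↔
      Attainable (d + e) e (x * y / (1 - y ^ 2)) (x / (1 - y ^ 2)) := by
  have hD : 0 < 1 - y ^ 2 := by nlinarith
  constructor
  · rintro ⟨b, c, rfl, rfl, hs⟩
    rw [schur_step_low e hd b hy1, ← schurStable_div (one_sub_mul_conj_ne_zero hy1)] at hs
    refine ⟨_, _, ?_, ?_, hs⟩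
    · rw [norm_div, norm_one_sub_mul_conj hy1, norm_mul, norm_neg, Complex.norm_conj, mul_comm]
    · rw [norm_div, norm_one_sub_mul_conj hy1]
  · rintro ⟨b', c', hb, hc, hs⟩
    -- The witnesses solve `b' = -c b̄ / (1 - |c|^2)`, `c' = b / (1 - |c|^2)` for `b` and `c`, given
    -- `|c| = y`.
    have hc0 : conj c' ≠ 0 := by
      rw [← norm_ne_zero_iff, Complex.norm_conj, hc]
      positivity
    have hcn : ‖-b' / conj c'‖ = y := by
      rw [norm_div, norm_neg, Complex.norm_conj, hb, hc]
      field_simp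
    have hD' : ((1 - y ^ 2 : ℝ) : ℂ) ≠ 0 := by exact_mod_cast hD.ne'
    have hyc : ‖-b' / conj c'‖ < 1 := hcn ▸ hy1
    refine ⟨((1 - y ^ 2 : ℝ) : ℂ) * c', -b' / conj c', ?_, hcn, ?_⟩
    · rw [norm_mul, hc, Complex.norm_real, Real.norm_of_nonneg hD.le]
      field_simp
    · rw [schur_step_low e hd _ hyc, ← schurStable_div (one_sub_mul_conj_ne_zero hyc)]
      have e1 : 1 - -b' / conj c' * conj (-b' / conj c') = ((1 - y ^ 2 : ℝ) : ℂ) := by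
        rw [Complex.mul_conj, Complex.normSq_eq_norm_sq, hcn]
        push_cast
        rfl
      rw [e1, map_mul, Complex.conj_ofReal]
      convert hs using 1 <;> field_simp

theorem attainable_high {d : ℕ} (e : ℕ) (hd : 0 < d) {x y : ℝ} (hx : 0 < x) (hy : 0 < y)
    (hy1 : y < 1) : Attainable (2 * d + e) (d + e) x y ↔
      Attainable (d + e) e (x / (1 - y ^ 2)) (x * y / (1 - y ^ 2)) := by
  have hD : 0 < 1 - y ^ 2 := by nlinarith
  constructor
  · rintro ⟨b, c, rfl, rfl, hs⟩
    rw [schur_step_high e hd b hy1, ← schurStable_div (one_sub_mul_conj_ne_zero hy1)] at hs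
    refine ⟨_, _, ?_, ?_, hs⟩
    · rw [norm_div, norm_one_sub_mul_conj hy1]
    · rw [norm_div, norm_one_sub_mul_conj hy1, norm_mul, norm_neg, Complex.norm_conj, mul_comm]
  · rintro ⟨b', c', hb, hc, hs⟩
    have hb0 : conj b' ≠ 0 := by
      rw [← norm_ne_zero_iff, Complex.norm_conj, hb]
      positivity
    have hcn : ‖-c' / conj b'‖ = y := by
      rw [norm_div, norm_neg, Complex.norm_conj, hb, hc]
      field_simp
    have hD' : ((1 - y ^ 2 : ℝ) : ℂ) ≠ 0 := by exact_mod_cast hD.ne'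
    have hyc : ‖-c' / conj b'‖ < 1 := hcn ▸ hy1
    refine ⟨((1 - y ^ 2 : ℝ) : ℂ) * b', -c' / conj b', ?_, hcn, ?_⟩
    · rw [norm_mul, hb, Complex.norm_real, Real.norm_of_nonneg hD.le]
      field_simp
    · rw [schur_step_high e hd _ hyc, ← schurStable_div (one_sub_mul_conj_ne_zero hyc)]
      have e1 : 1 - -c' / conj b' * conj (-c' / conj b') = ((1 - y ^ 2 : ℝ) : ℂ) := by
        rw [Complex.mul_conj, Complex.normSq_eq_norm_sq, hcn]
        push_cast
        rfl
      rw [e1, map_mul, Complex.conj_ofReal]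
      convert hs using 1 <;> field_simp

/-! ### Angles of the triangle with sides 1, x, y -/

/-- The angle opposite to the side `1` in a triangle with sides `1`, `x`, `y`. -/
noncomputable def unitAngle (x y : ℝ) : ℝ :=
  Real.arccos ((x ^ 2 + y ^ 2 - 1) / (2 * x * y))

/-- The angle opposite to the side `x` in a triangle with sides `1`, `x`, `y`. -/
noncomputable def sideAngle (x y : ℝ) : ℝ :=
  Real.arccos ((1 - x ^ 2 + y ^ 2) / (2 * y))

theorem unitAngle_comm (x y : ℝ) : unitAngle x y = unitAngle y x := by
  unfold unitAngle
  congr 1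
  ring

section Triangle

variable {x y : ℝ}

theorem unitAngle_eq_zero (hx : 0 < x) (hy : 0 < y) (h : 1 + y ≤ x) : unitAngle x y = 0 := by
  rw [unitAngle, Real.arccos_eq_zero, one_le_div (by positivity)]
  nlinarith

theorem sideAngle_eq_pi (hy : 0 < y) (h : 1 + y ≤ x) : sideAngle x y = Real.pi := by
  rw [sideAngle, Real.arccos_eq_pi, div_le_iff₀ (by positivity)]
  nlinarith

theorem sideAngle_eq_zero (hx : 0 < x) (hy : 0 < y) (h : 1 + x ≤ y) : sideAngle x y = 0 := by
  rw [sideAngle, Real.arccos_eq_zero, one_le_div (by positivity)]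
  nlinarith

/-- Sixteen times the squared area of a triangle with sides `1`, `x`, `y` (Heron). -/
def heron (x y : ℝ) : ℝ := (x + y + 1) * (x + y - 1) * (1 + x - y) * (1 + y - x)

theorem heron_nonneg (hx : 0 < x) (hy : 0 < y) (h1 : 1 ≤ x + y) (h2 : y ≤ 1 + x)
    (h3 : x ≤ 1 + y) : 0 ≤ heron x y := by
  have := sub_nonneg.2 h1
  have := sub_nonneg.2 h2
  have := sub_nonneg.2 h3
  unfold heron
  positivity

theorem heron_comm (x y : ℝ) : heron x y = heron y x := by
  unfold heron
  ring

theorem cos_unitAngle (hx : 0 < x) (hy : 0 < y) (h1 : 1 ≤ x + y) (h2 : y ≤ 1 + x)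
    (h3 : x ≤ 1 + y) : Real.cos (unitAngle x y) = (x ^ 2 + y ^ 2 - 1) / (2 * x * y) := by
  refine Real.cos_arccos ?_ ?_
  · rw [le_div_iff₀ (by positivity)]
    nlinarith
  · rw [div_le_iff₀ (by positivity)]
    nlinarith

theorem cos_sideAngle (hx : 0 < x) (hy : 0 < y) (h1 : 1 ≤ x + y) (h2 : y ≤ 1 + x)
    (h3 : x ≤ 1 + y) : Real.cos (sideAngle x y) = (1 - x ^ 2 + y ^ 2) / (2 * y) := by
  refine Real.cos_arccos ?_ ?_
  · rw [le_div_iff₀ (by positivity)]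
    nlinarith
  · rw [div_le_iff₀ (by positivity)]
    nlinarith

theorem sin_unitAngle (hx : 0 < x) (hy : 0 < y) :
    Real.sin (unitAngle x y) = √(heron x y) / (2 * x * y) := by
  rw [unitAngle, Real.sin_arccos]
  have : 1 - ((x ^ 2 + y ^ 2 - 1) / (2 * x * y)) ^ 2 = heron x y / (2 * x * y) ^ 2 := by
    unfold heron
    field_simp
    ring
  rw [this, Real.sqrt_div' _ (by positivity), Real.sqrt_sq (by positivity)]

theorem sin_sideAngle (hy : 0 < y) : Real.sin (sideAngle x y) = √(heron x y) / (2 * y) := by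
  rw [sideAngle, Real.sin_arccos]
  have : 1 - ((1 - x ^ 2 + y ^ 2) / (2 * y)) ^ 2 = heron x y / (2 * y) ^ 2 := by
    unfold heron
    field_simp
    ring
  rw [this, Real.sqrt_div' _ (by positivity), Real.sqrt_sq (by positivity)]

/-- Places the sum of two angles in the range where `arccos` inverts `cos`, which `angle_sum`
requires; it also yields `2ω ≤ n`. -/
theorem unitAngle_add_sideAngle_le_pi (hx : 0 < x) (hy : 0 < y) (h1 : 1 ≤ x + y) :
    unitAngle x y + sideAngle x y ≤ Real.pi := by
  rcases le_total (1 + y) x with h | h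
  · rw [unitAngle_eq_zero hx hy h, sideAngle_eq_pi hy h, zero_add]
  · have : unitAngle x y ≤ Real.arccos (-((1 - x ^ 2 + y ^ 2) / (2 * y))) := by
      refine Real.arccos_le_arccos ?_
      have e : (x ^ 2 + y ^ 2 - 1) / (2 * x * y) - -((1 - x ^ 2 + y ^ 2) / (2 * y)) =
          (1 + x) * ((y + x - 1) * (1 + y - x)) / (2 * x * y) := by
        field_simp
        ring
      have := sub_nonneg.2 h
      have h4 : 0 ≤ y + x - 1 := by linarith
      rw [← sub_nonneg, e]
      positivity
    rw [Real.arccos_neg] at this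
    unfold sideAngle
    linarith

/-- The angle sum of a triangle, including the case `1 + y < x` of clipped arccosines. -/
theorem angle_sum (hx : 0 < x) (hy : 0 < y) (h1 : 1 ≤ x + y) (h2 : y ≤ 1 + x) :
    unitAngle x y + sideAngle x y + sideAngle y x = Real.pi := by
  rcases lt_or_ge (1 + y) x with h | h
  · rw [unitAngle_eq_zero hx hy h.le, sideAngle_eq_pi hy h.le, sideAngle_eq_zero hy hx h.le]
    ring
  have hK := heron_nonneg hx hy h1 h2 h
  have e : Real.cos (unitAngle x y + sideAngle x y) = -((1 - y ^ 2 + x ^ 2) / (2 * x)) := by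
    rw [Real.cos_add, cos_unitAngle hx hy h1 h2 h, cos_sideAngle hx hy h1 h2 h,
      sin_unitAngle hx hy, sin_sideAngle hy, div_mul_div_comm (√_), Real.mul_self_sqrt hK]
    unfold heron
    field_simp
    ring
  have e2 := Real.arccos_cos (add_nonneg (Real.arccos_nonneg _) (Real.arccos_nonneg _))
    (unitAngle_add_sideAngle_le_pi hx hy h1)
  change Real.arccos (Real.cos (unitAngle x y + sideAngle x y)) =
    unitAngle x y + sideAngle x y at e2
  rw [e, Real.arccos_neg] at e2
  change Real.pi - sideAngle y x = unitAngle x y + sideAngle x y at e2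
  linarith

theorem cosine_law_sub (hx : x ≠ 0) (hy : y ≠ 0) :
    (1 - y ^ 2 + x ^ 2) / (2 * x) - (x ^ 2 + y ^ 2 - 1) / (2 * x * y) =
      (1 - y) * (1 + y - x) * (1 + y + x) / (2 * x * y) := by
  field_simp
  ring

/-- The longer side faces the larger angle. -/
theorem unitAngle_le_sideAngle (hx : 0 < x) (hy : 1 ≤ y) (h1 : x ≤ 1 + y) :
    unitAngle x y ≤ sideAngle y x := by
  have hy0 : 0 < y := by linarith
  refine Real.arccos_le_arccos ?_
  rw [← sub_nonpos, cosine_law_sub hx.ne' hy0.ne']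
  exact div_nonpos_of_nonpos_of_nonneg (mul_nonpos_of_nonpos_of_nonneg
    (mul_nonpos_of_nonpos_of_nonneg (by linarith) (by linarith)) (by linarith)) (by positivity)

theorem two_mul_unitAngle_add_sideAngle_le_pi (hx : 0 < x) (hy : 1 ≤ y) :
    2 * unitAngle x y + sideAngle x y ≤ Real.pi := by
  have hy0 : 0 < y := by linarith
  rcases le_total (1 + y) x with h | h
  · rw [unitAngle_eq_zero hx hy0 h, sideAngle_eq_pi hy0 h]
    simp
  rcases le_total (1 + x) y with h2 | h2
  · rw [unitAngle_comm, unitAngle_eq_zero hy0 hx h2, sideAngle_eq_zero hx hy0 h2]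
    simp [Real.pi_nonneg]
  · linarith [unitAngle_le_sideAngle hx hy h, angle_sum hx hy0 (by linarith) h2]

/-- In a triangle `UVW` with `VW = 1`, `UW = x`, `UV = y`, take `P` on `VW` with `VP = y^2`. Then
`VPU` is similar to `VUW` with ratio `y`, so `PUW` has sides `xy`, `x`, `1 - y^2`. Its angles at `U,
W, P` are `α - γ`, `γ`, `π - α`; rescaling by `1 / (1 - y^2)` gives the reduced triangle. -/
theorem unitAngle_div (hx : 0 < x) (hy : 0 < y) (hy1 : y < 1) (h1 : 1 ≤ x + y) :
    unitAngle (x * y / (1 - y ^ 2)) (x / (1 - y ^ 2)) = unitAngle x y - sideAngle y x := by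
  have hD : 0 < 1 - y ^ 2 := by nlinarith
  have hx' : 0 < x / (1 - y ^ 2) := by positivity
  have hy' : 0 < x * y / (1 - y ^ 2) := by positivity
  have h2 : y ≤ 1 + x := by linarith
  rcases lt_or_ge (1 + y) x with h | h
  · rw [unitAngle_eq_zero hx hy h.le, sideAngle_eq_zero hy hx h.le, unitAngle_comm,
      unitAngle_eq_zero hx' hy', sub_zero]
    rw [← sub_nonneg]
    have e : x / (1 - y ^ 2) - (1 + x * y / (1 - y ^ 2)) =
        (1 - y) * (x - (1 + y)) / (1 - y ^ 2) := by
      field_simp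
      ring
    rw [e]
    exact div_nonneg (mul_nonneg (by linarith) (by linarith)) hD.le
  have hK := heron_nonneg hx hy h1 h2 h
  have e : Real.cos (unitAngle x y - sideAngle y x) =
      ((x * y / (1 - y ^ 2)) ^ 2 + (x / (1 - y ^ 2)) ^ 2 - 1) /
        (2 * (x * y / (1 - y ^ 2)) * (x / (1 - y ^ 2))) := by
    rw [Real.cos_sub, cos_unitAngle hx hy h1 h2 h,
      cos_sideAngle hy hx (by linarith) (by linarith) (by linarith),
      sin_unitAngle hx hy, sin_sideAngle hx, heron_comm y x, div_mul_div_comm (√_),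
      Real.mul_self_sqrt hK]
    unfold heron
    have := hD.ne'
    field_simp
    ring
  rw [unitAngle, ← e, Real.arccos_cos]
  -- `y < 1` gives `γ ≤ α`, so `arccos` recovers `α - γ` from its cosine.
  · rw [sub_nonneg]
    refine Real.arccos_le_arccos ?_
    have := sub_nonneg.2 hy1.le
    have := sub_nonneg.2 h
    rw [← sub_nonneg, cosine_law_sub hx.ne' hy.ne']
    positivity
  · have h3 : unitAngle x y ≤ Real.pi := Real.arccos_le_pi _
    have h4 : 0 ≤ sideAngle y x := Real.arccos_nonneg _
    linarith

theorem sideAngle_lt_unitAngle (hx : 0 < x) (hy : 0 < y) (hy1 : y < 1) (h1 : 1 ≤ x + y) :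
    sideAngle y x < unitAngle x y ↔ x < 1 + y := by
  constructor
  · intro h
    by_contra! h2
    rw [unitAngle_eq_zero hx hy h2] at h
    exact absurd (Real.arccos_nonneg _) (not_le.2 h)
  · intro h
    refine lt_of_not_ge fun h2 => ?_
    have h3 := Real.cos_le_cos_of_nonneg_of_le_pi (Real.arccos_nonneg _) (Real.arccos_le_pi _) h2
    change Real.cos (sideAngle y x) ≤ Real.cos (unitAngle x y) at h3
    rw [cos_unitAngle hx hy h1 (by linarith) h.le,
      cos_sideAngle hy hx (by linarith) (by linarith) (by linarith)] at h3
    have e := cosine_law_sub hx.ne' hy.ne'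
    have := sub_pos.2 hy1
    have := sub_pos.2 h
    have : 0 < (1 - y) * (1 + y - x) * (1 + y + x) / (2 * x * y) := by positivity
    linarith

theorem sideAngle_div_low (hx : 0 < x) (hy : 0 < y) (hy1 : y < 1) :
    sideAngle (x * y / (1 - y ^ 2)) (x / (1 - y ^ 2)) = sideAngle y x := by
  have hD : 1 - y ^ 2 ≠ 0 := by nlinarith
  unfold sideAngle
  congr 1
  field_simp
  ring

theorem sideAngle_div_high (hx : 0 < x) (hy : 0 < y) (hy1 : y < 1) :
    sideAngle (x / (1 - y ^ 2)) (x * y / (1 - y ^ 2)) = Real.pi - unitAngle x y := by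
  have hD : 1 - y ^ 2 ≠ 0 := by nlinarith
  unfold sideAngle unitAngle
  rw [← Real.arccos_neg]
  congr 1
  field_simp
  ring

/-! ### The region under reduction -/

/-- The region of the moduli of Schur stable trinomials with both lower coefficients nonzero. -/
def InRegion (n m : ℕ) (x y : ℝ) : Prop :=
  x + y < 1 ∨ (1 ≤ x + y ∧ ((n : ℝ) - 1) * Real.pi < n * unitAngle x y + m * sideAngle x y)

/-- The sum on the left is `x / (1 - y)`. -/
theorem add_div_one_sub_sq_lt_one (hy : 0 < y) (hy1 : y < 1) :
    x * y / (1 - y ^ 2) + x / (1 - y ^ 2) < 1 ↔ x + y < 1 := by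
  have hD : 0 < 1 - y ^ 2 := by nlinarith
  rw [← add_div, div_lt_one hD]
  constructor <;> intro h <;> nlinarith

/-- Subtracting `dπ = d(α + β + γ)` from `(2d + e - 1)π < (2d + e)α + dβ` leaves `(d + e - 1)π < (d
+ e)(α - γ) + eγ`. -/
theorem inRegion_low (d e : ℕ) (hx : 0 < x) (hy : 0 < y) (hy1 : y < 1) :
    InRegion (2 * d + e) d x y ↔
      InRegion (d + e) e (x * y / (1 - y ^ 2)) (x / (1 - y ^ 2)) := by
  unfold InRegion
  rw [← not_lt (b := (1 : ℝ)), ← not_lt (b := (1 : ℝ)), add_div_one_sub_sq_lt_one hy hy1]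
  refine or_congr Iff.rfl (and_congr_right fun h => ?_)
  have h1 := not_lt.1 h
  rw [unitAngle_div hx hy hy1 h1, sideAngle_div_low hx hy hy1]
  have := angle_sum hx hy h1 (by linarith)
  push_cast
  rw [← this]
  constructor <;> intro h <;> nlinarith

theorem inRegion_high (d e : ℕ) (hx : 0 < x) (hy : 0 < y) (hy1 : y < 1) :
    InRegion (2 * d + e) (d + e) x y ↔
      InRegion (d + e) e (x / (1 - y ^ 2)) (x * y / (1 - y ^ 2)) := by
  unfold InRegion
  rw [← not_lt (b := (1 : ℝ)), ← not_lt (b := (1 : ℝ)), add_comm (x / _),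
    add_div_one_sub_sq_lt_one hy hy1]
  refine or_congr Iff.rfl (and_congr_right fun h => ?_)
  have h1 := not_lt.1 h
  rw [unitAngle_comm (x / _), unitAngle_div hx hy hy1 h1, sideAngle_div_high hx hy hy1]
  have := angle_sum hx hy h1 (by linarith)
  push_cast
  rw [← this]
  constructor <;> intro h <;> nlinarith

/-- With `m = j + 1` and `n = m + k + 1`, `nα + mβ = (2α + β) + (j + k)(α + β) - kβ`, which is at
most `(n - 1)π`. -/
theorem not_inRegion_of_one_le {n m : ℕ} (hm : 0 < m) (hmn : m < n) (hx : 0 < x) (hy : 1 ≤ y) :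
    ¬ InRegion n m x y := by
  have hy0 : 0 < y := by linarith
  rintro (h | ⟨h1, h⟩)
  · linarith
  obtain ⟨k, rfl⟩ := Nat.exists_eq_add_of_lt hmn
  obtain ⟨j, rfl⟩ := Nat.exists_eq_add_of_lt hm
  have h2 := two_mul_unitAngle_add_sideAngle_le_pi hx hy
  have h3 := unitAngle_add_sideAngle_le_pi hx hy0 h1
  have h4 : 0 ≤ unitAngle x y := Real.arccos_nonneg _
  have h5 : 0 ≤ sideAngle x y := Real.arccos_nonneg _
  push_cast at h
  have h6 := mul_le_mul_of_nonneg_left h3 (Nat.cast_nonneg (α := ℝ) (j + k))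
  have h7 := mul_nonneg (Nat.cast_nonneg (α := ℝ) k) h5
  push_cast at h6
  nlinarith

/-! ### Base case and Euclidean induction -/

theorem not_attainable_of_one_le {n m : ℕ} (hm : 0 < m) (hmn : m < n) (hy : 1 ≤ y) :
    ¬ Attainable n m x y := by
  rintro ⟨b, c, -, rfl, hs⟩
  exact absurd (norm_lt_one_of_schurStable hm hmn hs) (not_lt.2 hy)

/-- By the angle sum, `2α + β > π` means `α > γ`. -/
theorem inRegion_two_one (hx : 0 < x) (hy : 0 < y) (hy1 : y < 1) :
    InRegion 2 1 x y ↔ x < 1 + y := by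
  unfold InRegion
  constructor
  · rintro (h | ⟨h1, h⟩)
    · linarith
    · rw [← sideAngle_lt_unitAngle hx hy hy1 h1]
      have := angle_sum hx hy h1 (by linarith)
      push_cast at h
      linarith
  · intro h
    rcases lt_or_ge (x + y) 1 with h1 | h1
    · exact .inl h1
    · refine .inr ⟨h1, ?_⟩
      rw [← sideAngle_lt_unitAngle hx hy hy1 h1] at h
      have := angle_sum hx hy h1 (by linarith)
      push_cast
      linarith

/-- One reduction leaves `z + b' + c'`, whose root is `-(b' + c')`. With the moduli fixed, its least
modulus is `x / (1 + y)`, reached when `b'` and `c'` have opposite signs. -/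
theorem attainable_two_one (hx : 0 < x) (hy : 0 < y) (hy1 : y < 1) :
    Attainable 2 1 x y ↔ x < 1 + y := by
  have hD : 0 < 1 - y ^ 2 := by nlinarith
  rw [show (2 : ℕ) = 2 * 1 + 0 from rfl, attainable_low 0 one_pos hx hy hy1]
  have hx' : 0 < x / (1 - y ^ 2) := by positivity
  constructor
  · rintro ⟨b, c, hb, hc, hs⟩
    have h := hs (-(b + c)) (by simp)
    have h1 := norm_sub_norm_le c (-b)
    rw [norm_neg, hb, hc, sub_neg_eq_add, add_comm c] at h1
    rw [norm_neg] at h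
    have h2 := h1.trans_lt h
    rw [← sub_div, div_lt_one hD] at h2
    nlinarith
  · intro h
    refine ⟨((-(x * y / (1 - y ^ 2)) : ℝ) : ℂ), ((x / (1 - y ^ 2) : ℝ) : ℂ), ?_, ?_, ?_⟩
    · rw [Complex.norm_real, norm_neg, Real.norm_of_nonneg (by positivity)]
    · rw [Complex.norm_real, Real.norm_of_nonneg (by positivity)]
    · intro z hz
      have e : z = ((x * y / (1 - y ^ 2) - x / (1 - y ^ 2) : ℝ) : ℂ) := by
        push_cast at hz ⊢
        simp only [pow_one, pow_zero] at hz
        linear_combination hz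
      rw [e, Complex.norm_real, ← sub_div, Real.norm_eq_abs, abs_lt, lt_div_iff₀ hD,
        div_lt_one hD]
      constructor <;> nlinarith

/-- The Euclidean algorithm on the exponents carries the reduction of stability in parallel to
the reduction of the region. -/
theorem attainable_iff_inRegion {n m : ℕ} (hm : 0 < m) (hmn : m < n) (hcop : Nat.Coprime n m)
    (hx : 0 < x) (hy : 0 < y) : Attainable n m x y ↔ InRegion n m x y := by
  induction n using Nat.strong_induction_on generalizing m x y with
  | _ n ih =>
    rcases le_or_gt 1 y with hy1 | hy1
    · exact iff_of_false (not_attainable_of_one_le hm hmn hy1)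
        (not_inRegion_of_one_le hm hmn hx hy1)
    have hD : 0 < 1 - y ^ 2 := by nlinarith
    have hx' : 0 < x / (1 - y ^ 2) := by positivity
    have hy' : 0 < x * y / (1 - y ^ 2) := by positivity
    rcases lt_trichotomy (2 * m) n with h | h | h
    -- The exponents become `n - m` and `n - 2m = e + 1`.
    · obtain ⟨e, rfl⟩ := Nat.exists_eq_add_of_lt h
      rw [add_assoc] at *
      rw [attainable_low _ hm hx hy hy1, inRegion_low _ _ hx hy hy1]
      refine ih _ (by omega) (by omega) (by omega) ?_ hy' hx'
      have h1 : Nat.Coprime (e + 1) m := by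
        rw [add_comm, mul_comm] at hcop
        simpa using hcop
      simpa using h1.symm
    · have h1 : m = 1 := by
        rw [← h] at hcop
        exact hcop.symm.eq_one_of_dvd (dvd_mul_left m 2)
      subst h1
      subst h
      rw [attainable_two_one hx hy hy1, inRegion_two_one hx hy hy1]
    -- With `d + 1 = n - m`, the exponents become `m` and `2m - n = e`.
    · obtain ⟨d, rfl⟩ := Nat.exists_eq_add_of_lt hmn
      obtain ⟨e, rfl⟩ : ∃ e, m = (d + 1) + e := ⟨m - (d + 1), by omega⟩
      have hn : d + 1 + e + d + 1 = 2 * (d + 1) + e := by omega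
      rw [hn, attainable_high _ d.succ_pos hx hy hy1, inRegion_high _ _ hx hy hy1]
      refine ih _ (by omega) (by omega) (by omega) ?_ hx' hy'
      have h1 : Nat.Coprime (d + 1) (d + 1 + e) := by
        have : d + 1 + e + d + 1 = (d + 1) + (d + 1 + e) := by omega
        rw [this] at hcop
        simpa using hcop
      have h2 : Nat.Coprime (d + 1) e := by simpa using h1
      simpa using h2

end Triangle

/-! ### Zero coefficients and passage to the projective plane -/

theorem attainable_of_add_lt_one {n m : ℕ} (hmn : m < n) {x y : ℝ} (hx : 0 ≤ x) (hy : 0 ≤ y)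
    (h : x + y < 1) : Attainable n m x y := by
  refine ⟨(x : ℂ), (y : ℂ), ?_, ?_, schurStable_of_norm_add_norm_lt_one hmn ?_⟩ <;>
  simp [abs_of_nonneg hx, abs_of_nonneg hy, h]

theorem lt_one_of_attainable_zero {n m : ℕ} (hmn : m < n) {x : ℝ}
    (h : Attainable n m x 0) : x < 1 := by
  obtain ⟨b, c, rfl, hc, hs⟩ := h
  rw [norm_eq_zero] at hc
  subst hc
  -- For `c = 0` the trinomial is `z^m (z^(n-m) + b)`, so a root of the second factor bounds `|b|`.
  obtain ⟨z, hz⟩ := IsAlgClosed.exists_pow_nat_eq (-b) (Nat.sub_pos_of_lt hmn)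
  have h1 := hs z (by
    rw [← Nat.add_sub_of_le hmn.le, pow_add, hz]
    ring)
  rw [← norm_neg, ← hz, norm_pow]
  exact pow_lt_one₀ (norm_nonneg _) h1 (Nat.sub_pos_of_lt hmn).ne'

theorem two_mul_omega (n m : ℕ) (x y : ℝ) :
    2 * omega n m x y = (n * unitAngle x |y| + m * sideAngle x |y|) / Real.pi := by
  unfold omega unitAngle sideAngle
  have := Real.pi_ne_zero
  rw [sq_abs]
  field_simp

/-- The description of the attainable moduli by `omega`, where `y` may have either sign. -/
theorem attainable_iff {n m : ℕ} (hm : 0 < m) (hmn : m < n) (hcop : Nat.Coprime n m) {x y : ℝ}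
    (hx : 0 ≤ x) : Attainable n m x |y| ↔
      (0 < x ∧ 0 < |y| ∧ 1 ≤ x + |y| ∧ (n : ℝ) - 1 < 2 * omega n m x y ∧ 2 * omega n m x y ≤ n) ∨
        x + |y| < 1 := by
  constructor
  · intro h
    have hy1 : |y| < 1 := by
      by_contra! h1
      exact not_attainable_of_one_le hm hmn h1 h
    rcases hx.eq_or_lt with rfl | hx
    · exact .inr (by simpa using hy1)
    rcases (abs_nonneg y).eq_or_lt with h0 | hy
    · rw [← h0] at h ⊢
      exact .inr (by simpa using lt_one_of_attainable_zero hmn h)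
    rw [attainable_iff_inRegion hm hmn hcop hx hy] at h
    rcases h with h | ⟨h1, h⟩
    · exact .inr h
    · rw [← lt_div_iff₀ Real.pi_pos, ← two_mul_omega] at h
      refine .inl ⟨hx, hy, h1, h, ?_⟩
      -- The upper bound is automatic: `m ≤ n` and `α + β ≤ π`.
      rw [two_mul_omega, div_le_iff₀ Real.pi_pos]
      calc n * unitAngle x |y| + m * sideAngle x |y|
          ≤ n * unitAngle x |y| + n * sideAngle x |y| := by
            gcongr
            exact Real.arccos_nonneg _
        _ = n * (unitAngle x |y| + sideAngle x |y|) := by ring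
        _ ≤ n * Real.pi := by
            gcongr
            exact unitAngle_add_sideAngle_le_pi hx hy h1
  · rintro (⟨hx, hy, h1, h, -⟩ | h)
    · rw [attainable_iff_inRegion hm hmn hcop hx hy]
      refine .inr ⟨h1, ?_⟩
      rwa [← lt_div_iff₀ Real.pi_pos, ← two_mul_omega]
    · exact attainable_of_add_lt_one hmn hx (abs_nonneg y) h

theorem mem_range_projection {n m : ℕ} {p : Plane ℝ} : p ∈ Set.range (projection n m) ↔
    ∃ x y : ℝ, p = point x ((-1) ^ n * y) ∧ Attainable n m x y := by
  constructor
  · rintro ⟨⟨_, b, c, rfl, hs⟩, rfl⟩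
    exact ⟨_, _, projection_point n m b c _, b, c, rfl, rfl, hs⟩
  · rintro ⟨_, _, rfl, b, c, rfl, rfl, hs⟩
    exact ⟨⟨point b c, b, c, rfl, hs⟩, projection_point n m b c _⟩

theorem Attainable.nonneg {n m : ℕ} {x y : ℝ} (h : Attainable n m x y) : 0 ≤ x ∧ 0 ≤ y := by
  obtain ⟨b, c, rfl, rfl, -⟩ := h
  exact ⟨norm_nonneg b, norm_nonneg c⟩

theorem range_projection_of_even {n m : ℕ} (hm : 0 < m) (hmn : m < n) (hcop : Nat.Coprime n m)
    (hn : Even n) : Set.range (projection n m) = Delta0 n m ∪ Gamma0 := by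
  ext p
  simp only [mem_range_projection, hn.neg_one_pow, one_mul, Delta0, Gamma0, Set.mem_union,
    Set.mem_ofPred_eq]
  constructor
  · rintro ⟨x, y, rfl, h⟩
    obtain ⟨hx, hy⟩ := h.nonneg
    rw [← abs_of_nonneg hy, attainable_iff hm hmn hcop hx, abs_of_nonneg hy] at h
    rcases h with h | h
    · exact .inl ⟨x, y, rfl, h⟩
    · exact .inr ⟨x, y, rfl, hx, hy, h⟩
  · rintro (⟨x, y, rfl, h⟩ | ⟨x, y, rfl, hx, hy, h⟩) <;> refine ⟨x, y, rfl, ?_⟩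
    · rw [← abs_of_pos h.2.1, attainable_iff hm hmn hcop h.1.le, abs_of_pos h.2.1]
      exact .inl h
    · exact attainable_of_add_lt_one hmn hx hy h

theorem range_projection_of_odd {n m : ℕ} (hm : 0 < m) (hmn : m < n) (hcop : Nat.Coprime n m)
    (hn : Odd n) : Set.range (projection n m) = Delta1 n m ∪ Gamma1 := by
  ext p
  simp only [mem_range_projection, hn.neg_one_pow, neg_one_mul, Delta1, Gamma1, Set.mem_union,
    Set.mem_ofPred_eq]
  constructor
  · rintro ⟨x, y, rfl, h⟩
    obtain ⟨hx, hy⟩ := h.nonneg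
    have hy' : |-y| = y := by rw [abs_neg, abs_of_nonneg hy]
    rw [← hy', attainable_iff hm hmn hcop hx, hy'] at h
    rcases h with ⟨h0, h1, h2, h3⟩ | h
    · exact .inl ⟨x, -y, rfl, h0, by linarith, by linarith, h3⟩
    · exact .inr ⟨x, -y, rfl, hx, by linarith, by linarith⟩
  · rintro (⟨x, y, rfl, h0, h1, h2, h3⟩ | ⟨x, y, rfl, hx, hy, h⟩) <;>
      refine ⟨x, -y, by rw [neg_neg], ?_⟩
    · rw [← abs_of_neg h1, attainable_iff hm hmn hcop h0.le, abs_of_neg h1]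
      exact .inl ⟨h0, by linarith, by linarith, h3⟩
    · exact attainable_of_add_lt_one hmn hx (by linarith) (by linarith)

end SchurTrinomial

theorem lemmaA2 (n m : ℕ) (hm : 0 < m) (hmn : m < n) (hcop : Nat.gcd n m = 1) :
    (Even n → Set.range (SchurTrinomial.projection n m) =
      SchurTrinomial.Delta0 n m ∪ SchurTrinomial.Gamma0) ∧
    (Odd n → Set.range (SchurTrinomial.projection n m) =
      SchurTrinomial.Delta1 n m ∪ SchurTrinomial.Gamma1) :=
  ⟨SchurTrinomial.range_projection_of_even hm hmn hcop,
    SchurTrinomial.range_projection_of_odd hm hmn hcop⟩
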